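/- **Theorem (Lossless Recovery).** Let $\mathcal V$ be a finite vocabulary and let $p$ (target) and $q$ (draft) be autoregressive models over $\mathcal V$, i.e. families of next-token distributions $p(\cdot\mid X_{1:t})$, $q(\cdot\mid X_{1:t})$ on $\mathcal V$. Write $p(X_{a+1:b}\mid X_{1:a})=\prod_{i=a+1}^{b}p(x_i\mid X_{1:i-1})$ and $p(X_{1:t})=\prod_{i=1}^{t}p(x_i\mid X_{1:i-1})$, similarly for $q$, and $$r(X_{1:t})=\frac{p(X_{1:t})}{q(X_{1:t})},\qquad r(X_{a+1:b})=\frac{p(X_{a+1:b}\mid X_{1:a})}{q(X_{a+1:b}\mid X_{1:a})}.$$ Let $m=m(X_{1:t})$ be the (largest) index maximizing $r(X_{1:i})$ over $1\le i<t$ if this maximum exceeds $1$, and $m=0$ otherwise. Define the capped prefix ratio $$r^*(X_{1:t})=\min\{r(X_{1:m}),1\}\,r(X_{m+1:t}),$$ and the capped branch divergences, where $X_{1:t}$ ranges over the one-token extensions of $X_{1:t-1}$, $$D^*(p,q\mid X_{1:t-1})=\sum_{x_t\in\mathcal V:\ r^*(X_{1:t})>1}(r^*(X_{1:t})-1)\,q(X_{1:t}),\qquad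 D^*(q,p\mid X_{1:t-1})=\sum_{x_t\in\mathcal V:\ r^*(X_{1:t})\le 1}(1-r^*(X_{1:t}))\,q(X_{1:t}).$$ If $q(X_{1:t})=0$, the product $r^*(X_{1:t})\,q(X_{1:t})$ is read as $q(X_{1:m})\,p(X_{m+1:t}\mid X_{1:m})$, to which it is equal whenever $q(X_{1:t})>0$, and the term is counted in $D^*(p,q\mid X_{1:t-1})$. Let $$P^*_{\mathrm{res}}(x_t\mid X_{1:t-1})=\frac{\max\{q(X_{1:t})(r^*(X_{1:t})-1),\,0\}}{D^*(p,q\mid X_{1:t-1})},$$ and for a draft $X_{1:\gamma}$ let $$h_\gamma=\min\{r^*(X_{1:\gamma}),1\},\qquad h_t=\frac{D^*(p,q\mid X_{1:t})}{D^*(q,p\mid X_{1:t})}\quad(1\le t<\gamma).$$ (If a denominator is zero, take $h_t=0$, respectively $P^*_{\mathrm{res}}=p$; these cases occur with probability zero.) Hierarchical speculative decoding (HSD) with capped branch resampling runs as follows. Draw a draft $X_{1:\gamma}$ from $q$. For $t=\gamma,\gamma-1,\dots,1$ draw a fresh $\eta_t\sim U(0,1)$ and stop with $\tau=t$ at the first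 $t$ for which $h_t\ge\eta_t$; if there is none, set $\tau=0$. If $\tau=\gamma$, output $X_{1:\gamma}$ followed by a token drawn from $p(\cdot\mid X_{1:\gamma})$. If $\tau<\gamma$, output $X_{1:\tau}$ followed by a single token drawn from $P^*_{\mathrm{res}}(\cdot\mid X_{1:\tau})$, and, if this output is shorter than $\gamma$, continue it up to length $\gamma$ by sampling from the target $p$. Then for all $p$, $q$, $\gamma$ and every sequence $X_{1:\gamma}\in\mathcal V^\gamma$, the probability that the first $\gamma$ generated tokens are $X_{1:\gamma}$ equals the target probability: $$P\bigl(X_{1:\gamma}\text{ is generated}\bigr)=p(X_{1:\gamma}).$$ -/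

import Mathlib

namespace HSD

open MeasureTheory

/-- An autoregressive language model over the vocabulary `V`: the distribution of the next token
given the tokens generated so far (a fixed prompt is absorbed into the model). -/
abbrev Model (V : Type*) := List V → PMF V

section Ratios

variable {V : Type*}

/-- `condProb p pre suf` is `p(suf ∣ pre)`, the probability that the model `p` continues `pre`
by the tokens `suf`: a product of next-token probabilities. -/
noncomputable def condProb (p : Model V) : List V → List V → ℝ
  | _, [] => 1
  | pre, x :: suf => (p pre x).toReal * condProb p (pre ++ [x]) suf

/-- The joint probability `p(X_{1:t})`. -/
noncomputable def jointProb (p : Model V) (xs : List V) : ℝ := condProb p [] xs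

/-- The ratio `r(suf ∣ pre) = p(suf ∣ pre) / q(suf ∣ pre)`. -/
noncomputable def condRatio (p q : Model V) (pre suf : List V) : ℝ :=
  condProb p pre suf / condProb q pre suf

/-- The prefix ratio `r(X_{1:t}) = p(X_{1:t}) / q(X_{1:t})`. -/
noncomputable def ratio (p q : Model V) (xs : List V) : ℝ := jointProb p xs / jointProb q xs

open Classical in
/-- The maximum prefix ratio index `m(X_{1:t})`: the (largest) index `1 ≤ i < t` that maximizes
`r(X_{1:i})`, if that maximum exceeds `1`, and `0` otherwise. -/
noncomputable def maxIndex (p q : Model V) (xs : List V) : ℕ :=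
  ((Finset.Ico 1 xs.length).filter fun i =>
    1 < ratio p q (xs.take i) ∧
      ∀ j ∈ Finset.Ico 1 xs.length, ratio p q (xs.take j) ≤ ratio p q (xs.take i)).sup id

/-- The capped prefix ratio
`r*(X_{1:t}) = min {r(X_{1:m}), 1} * r(X_{m+1:t} ∣ X_{1:m})` with `m = m(X_{1:t})`. -/
noncomputable def cappedRatio (p q : Model V) (xs : List V) : ℝ :=
  min (ratio p q (xs.take (maxIndex p q xs))) 1 *
    condRatio p q (xs.take (maxIndex p q xs)) (xs.drop (maxIndex p q xs))

open Classical in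
/-- The signed mass `(r*(X_{1:t}) - 1) q(X_{1:t})`. If `q(X_{1:t}) = 0`, the ratio is not defined
and `q(X_{1:t}) r*(X_{1:t})` is read as `q(X_{1:m}) p(X_{m+1:t} ∣ X_{1:m})`, `m = m(X_{1:t})`, to
which it is equal whenever `q(X_{1:t}) > 0`. -/
noncomputable def cappedExcess (p q : Model V) (xs : List V) : ℝ :=
  if jointProb q xs = 0 then
    jointProb q (xs.take (maxIndex p q xs)) *
      condProb p (xs.take (maxIndex p q xs)) (xs.drop (maxIndex p q xs))
  else (cappedRatio p q xs - 1) * jointProb q xs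

end Ratios

section Branch

variable {V : Type*} [Fintype V]

/-- The capped branch divergence `D*(p, q ∣ pre)`: the sum of `(r* - 1) q` over the one-token
extensions of `pre` with `r* > 1`. -/
noncomputable def cappedDivPQ (p q : Model V) (pre : List V) : ℝ :=
  ∑ x : V, max (cappedExcess p q (pre ++ [x])) 0

/-- The capped branch divergence `D*(q, p ∣ pre)`: the sum of `(1 - r*) q` over the one-token
extensions of `pre` with `r* ≤ 1`. -/
noncomputable def cappedDivQP (p q : Model V) (pre : List V) : ℝ :=
  ∑ x : V, max (-cappedExcess p q (pre ++ [x])) 0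

theorem condProb_nonneg {V : Type*} (p : Model V) (pre suf : List V) : 0 ≤ condProb p pre suf := by
  induction suf generalizing pre with
  | nil => simp [condProb]
  | cons x s ih => exact mul_nonneg ENNReal.toReal_nonneg (ih _)

/-- On a branch whose tokens all have positive draft probability, `cappedDivPQ` is the sum of
`(r* - 1) q` over the extensions with `r* > 1`. -/
theorem cappedDivPQ_eq (p q : Model V) (pre : List V)
    (hq : ∀ x, jointProb q (pre ++ [x]) ≠ 0) :
    cappedDivPQ p q pre = ∑ x with 1 < cappedRatio p q (pre ++ [x]),
      (cappedRatio p q (pre ++ [x]) - 1) * jointProb q (pre ++ [x]) := by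
  rw [cappedDivPQ, Finset.sum_filter]
  refine Finset.sum_congr rfl fun x _ => ?_
  have h0 : 0 ≤ jointProb q (pre ++ [x]) := condProb_nonneg _ _ _
  rw [cappedExcess, if_neg (hq x)]
  split_ifs with h
  · exact max_eq_left (mul_nonneg (by linarith) h0)
  · exact max_eq_right (mul_nonpos_of_nonpos_of_nonneg (by linarith) h0)

/-- On a branch whose tokens all have positive draft probability, `cappedDivQP` is the sum of
`(1 - r*) q` over the extensions with `r* ≤ 1`. -/
theorem cappedDivQP_eq (p q : Model V) (pre : List V)
    (hq : ∀ x, jointProb q (pre ++ [x]) ≠ 0) :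
    cappedDivQP p q pre = ∑ x with cappedRatio p q (pre ++ [x]) ≤ 1,
      (1 - cappedRatio p q (pre ++ [x])) * jointProb q (pre ++ [x]) := by
  rw [cappedDivQP, Finset.sum_filter]
  refine Finset.sum_congr rfl fun x _ => ?_
  have h0 : 0 ≤ jointProb q (pre ++ [x]) := condProb_nonneg _ _ _
  rw [cappedExcess, if_neg (hq x), ← neg_mul, neg_sub]
  split_ifs with h
  · exact max_eq_left (mul_nonneg (by linarith) h0)
  · exact max_eq_right (mul_nonpos_of_nonpos_of_nonneg (by linarith) h0)

/-- The acceptance probability `h_t` for the draft `xs = X_{1:γ}`: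
`h_γ = min {r*(X_{1:γ}), 1}`, and `h_t = D*(p, q ∣ X_{1:t}) / D*(q, p ∣ X_{1:t})` for `t < γ`. -/
noncomputable def acceptProb (p q : Model V) (xs : List V) (t : ℕ) : ℝ :=
  if t = xs.length then min (cappedRatio p q xs) 1
  else cappedDivPQ p q (xs.take t) / cappedDivQP p q (xs.take t)

theorem sum_resample (p q : Model V) (pre : List V) (h : cappedDivPQ p q pre ≠ 0) :
    ∑ x : V, ENNReal.ofReal (max (cappedExcess p q (pre ++ [x])) 0 / cappedDivPQ p q pre) = 1 := by
  have h0 : 0 ≤ cappedDivPQ p q pre := Finset.sum_nonneg fun _ _ => le_max_right _ _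
  rw [← ENNReal.ofReal_sum_of_nonneg fun _ _ => div_nonneg (le_max_right _ _) h0,
    ← Finset.sum_div]
  change ENNReal.ofReal (cappedDivPQ p q pre / cappedDivPQ p q pre) = 1
  rw [div_self h, ENNReal.ofReal_one]

open Classical in
/-- The capped branch resampling distribution
`P*_res(x ∣ pre) = max {q(pre, x) (r*(pre, x) - 1), 0} / D*(p, q ∣ pre)`.
The verifier uses it with positive probability only if `D*(p, q ∣ pre) > 0`; the value in the
other case is immaterial. -/
noncomputable def resample (p q : Model V) (pre : List V) : PMF V :=
  if h : cappedDivPQ p q pre = 0 then p pre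
  else PMF.ofFintype
    (fun x => ENNReal.ofReal (max (cappedExcess p q (pre ++ [x])) 0 / cappedDivPQ p q pre))
    (sum_resample p q pre h)

end Branch

section Algorithm

/-- The uniform distribution `U(0,1)`. -/
noncomputable def uniform01 : Measure ℝ := volume.restrict (Set.Ioo 0 1)

instance : IsProbabilityMeasure uniform01 := ⟨by simp [uniform01]⟩

theorem measurable_decide_le (h : ℝ) : Measurable fun η : ℝ => decide (η ≤ h) :=
  measurable_to_bool (by
    have : (fun η : ℝ => decide (η ≤ h)) ⁻¹' {true} = Set.Iic h := by ext; simp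
    rw [this]; exact measurableSet_Iic)

/-- Sample `η ∼ U(0,1)` and return the truth value of `h ≥ η`. -/
noncomputable def acceptTest (h : ℝ) : PMF Bool :=
  haveI : IsProbabilityMeasure (uniform01.map fun η => decide (η ≤ h)) :=
    Measure.isProbabilityMeasure_map (measurable_decide_le h).aemeasurable
  (uniform01.map fun η => decide (η ≤ h)).toPMF

variable {V : Type*}

/-- Append `n` further tokens to `pre` by sampling successively from the model `p`. -/
noncomputable def extend (p : Model V) : ℕ → List V → PMF (List V)
  | 0, pre => PMF.pure pre
  | n + 1, pre => (p pre).bind fun x => extend p n (pre ++ [x])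

variable [Fintype V]

/-- Backward scan of the draft `xs` over the positions `t, t - 1, …, 1`, with a fresh uniform
variable at each position. It returns the first position that is accepted, and `0` if all
are rejected. -/
noncomputable def scan (p q : Model V) (xs : List V) : ℕ → PMF ℕ
  | 0 => PMF.pure 0
  | t + 1 => (acceptTest (acceptProb p q xs (t + 1))).bind fun accepted =>
      if accepted then PMF.pure (t + 1) else scan p q xs t

/-- Verification of the draft `xs = X_{1:γ}`: scan backward for the accepted length `τ`; if
`τ = γ`, append a bonus token from `p(· ∣ X_{1:γ})`, otherwise keep `X_{1:τ}` and append one token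
from `P*_res(· ∣ X_{1:τ})`. -/
noncomputable def verify (p q : Model V) (xs : List V) : PMF (List V) :=
  (scan p q xs xs.length).bind fun τ =>
    if τ = xs.length then (p xs).map fun x => xs ++ [x]
    else (resample p q (xs.take τ)).map fun x => xs.take τ ++ [x]

/-- Hierarchical speculative decoding with capped branch resampling, run until `γ` tokens are
generated: draft `γ` tokens from `q`, verify the draft, and continue the output by sampling from
the target `p` up to length `γ`. The result is the list of the first `γ` generated tokens. -/
noncomputable def generate (p q : Model V) (γ : ℕ) : PMF (List V) :=
  ((extend q γ []).bind (verify p q)).bind fun ys =>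
    (extend p (γ - ys.length) ys).map fun zs => zs.take γ

end Algorithm

end HSD

namespace HSD

open MeasureTheory

/-! ### Capped mass along a branch. -/

section Ratios

variable {V : Type*}

/-! Write M(u) ≥ 1 for the running maximum `maxRatio` over proper prefixes of u, a(u) = p(u)/M(u)
for the capped mass, and c(u) = min(a(u), q(u)) for its covered part. If q(u) ≠ 0, then a(ux) = c(u)
p(x∣u) (`cappedMass_append_singleton`). So the children of u carry total capped mass c(u) and total
draft mass q(u), whence D*(q,p∣u) - D*(p,q∣u) = q(u) - c(u).

By induction from the end of the draft, D*(q,p∣u) is the probability of drafting through u and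
rejecting every later position (`jointProb_mul_expect_rejectAfter`): acceptance at u removes
D*(p,q∣u) and leaves q(u) - c(u), which is u's summand in the D*(q,p) of its parent. Resampling
sends a(ux) - c(ux) = c(u) p(x∣u) - c(ux) of the accepted mass to x. Multiplied by the target
probability of the remaining tokens, these contributions telescope over τ < γ to p(X) - c(X)
(`expect_rejectAfter_mul_scanExpect`), and full acceptance supplies the missing c(X). -/

theorem condProb_append (p : Model V) (pre s t : List V) :
    condProb p pre (s ++ t) = condProb p pre s * condProb p (pre ++ s) t := by
  induction s generalizing pre with
  | nil => simp [condProb]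
  | cons x s ih => simp [condProb, ih, mul_assoc]

theorem jointProb_append (p : Model V) (s t : List V) :
    jointProb p (s ++ t) = jointProb p s * condProb p s t := by
  simp [jointProb, condProb_append]

theorem jointProb_append_singleton (p : Model V) (s : List V) (x : V) :
    jointProb p (s ++ [x]) = jointProb p s * (p s x).toReal := by
  simp [jointProb_append, condProb]

@[simp] theorem jointProb_nil (p : Model V) : jointProb p [] = 1 := rfl

theorem jointProb_nonneg (p : Model V) (s : List V) : 0 ≤ jointProb p s :=
  condProb_nonneg _ _ _

@[simp] theorem ratio_nil (p q : Model V) : ratio p q [] = 1 := by simp [ratio]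

theorem maxIndex_le_length (p q : Model V) (xs : List V) : maxIndex p q xs ≤ xs.length := by
  refine Finset.sup_le fun i hi => ?_
  simp only [Finset.mem_filter, Finset.mem_Ico] at hi
  exact hi.1.2.le

theorem maxIndex_append_singleton_le (p q : Model V) (pre : List V) (x : V) :
    maxIndex p q (pre ++ [x]) ≤ pre.length := by
  refine Finset.sup_le fun i hi => ?_
  simp only [Finset.mem_filter, Finset.mem_Ico, List.length_append, List.length_singleton] at hi
  exact Nat.lt_succ_iff.1 hi.1.2

/-- The largest prefix ratio `r(X_{1:m})`, which is `1` if `m = 0`. -/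
noncomputable def maxRatio (p q : Model V) (xs : List V) : ℝ :=
  ratio p q (xs.take (maxIndex p q xs))

theorem maxRatio_nil (p q : Model V) : maxRatio p q [] = 1 := by simp [maxRatio]

theorem maxIndex_spec (p q : Model V) (xs : List V) :
    (maxIndex p q xs = 0 ∧ ∀ j ∈ Finset.Ico 1 xs.length, ratio p q (xs.take j) ≤ 1) ∨
      (1 < maxRatio p q xs ∧
        ∀ j ∈ Finset.Ico 1 xs.length, ratio p q (xs.take j) ≤ maxRatio p q xs) := by
  -- Only membership in the filter is kept, so its classical decidability instance never has to be
  -- matched.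
  obtain ⟨s, hs, hm⟩ : ∃ s : Finset ℕ, (∀ i, i ∈ s ↔ i ∈ Finset.Ico 1 xs.length ∧
      1 < ratio p q (xs.take i) ∧
        ∀ j ∈ Finset.Ico 1 xs.length, ratio p q (xs.take j) ≤ ratio p q (xs.take i)) ∧
      maxIndex p q xs = s.sup id :=
    ⟨_, fun i => by simp only [Finset.mem_filter], rfl⟩
  rcases s.eq_empty_or_nonempty with h | h
  · refine Or.inl ⟨by rw [hm, h]; rfl, fun j hj => ?_⟩
    by_contra! hj1
    obtain ⟨i, hi, hmax⟩ := Finset.exists_max_image (Finset.Ico 1 xs.length)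
      (fun i => ratio p q (xs.take i)) ⟨j, hj⟩
    have : i ∈ s := (hs i).2 ⟨hi, hj1.trans_le (hmax j hj), hmax⟩
    simp [h] at this
  · obtain ⟨i, hi, hi'⟩ := Finset.exists_mem_eq_sup s h id
    rw [hi', id] at hm
    exact Or.inr (by rw [maxRatio, hm]; exact ((hs i).1 hi).2)

theorem one_le_maxRatio (p q : Model V) (xs : List V) : 1 ≤ maxRatio p q xs := by
  rcases maxIndex_spec p q xs with h | h
  · simp [maxRatio, h.1]
  · exact h.1.le

theorem ratio_take_le_maxRatio (p q : Model V) (xs : List V) {j : ℕ} (hj : j < xs.length) :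
    ratio p q (xs.take j) ≤ maxRatio p q xs := by
  rcases Nat.eq_zero_or_pos j with rfl | h0
  · simpa using one_le_maxRatio p q xs
  · have hj' : j ∈ Finset.Ico 1 xs.length := Finset.mem_Ico.2 ⟨h0, hj⟩
    rcases maxIndex_spec p q xs with h | h
    · exact (h.2 j hj').trans (one_le_maxRatio p q xs)
    · exact h.2 j hj'

/-- Appending a token makes `pre` itself a proper prefix, so the running maximum gains exactly one
competitor. -/
theorem maxRatio_append_singleton (p q : Model V) (pre : List V) (x : V) :
    maxRatio p q (pre ++ [x]) = max (maxRatio p q pre) (ratio p q pre) := by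
  have key : ∀ j ≤ pre.length, ratio p q (pre.take j) ≤ maxRatio p q (pre ++ [x]) := by
    intro j hj
    have := ratio_take_le_maxRatio p q (pre ++ [x]) (j := j) (by simp; omega)
    rwa [List.take_append_of_le_length hj] at this
  refine le_antisymm ?_ (max_le (key _ (maxIndex_le_length p q pre)) ?_)
  · have hm := maxIndex_append_singleton_le p q pre x
    rw [maxRatio, List.take_append_of_le_length hm]
    rcases hm.lt_or_eq with h | h
    · exact (ratio_take_le_maxRatio p q pre h).trans (le_max_left _ _)
    · rw [h, List.take_length]
      exact le_max_right _ _
  · simpa using key _ le_rfl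

/-- The mass `r*(X_{1:t}) q(X_{1:t})`, read as `q(X_{1:m}) p(X_{m+1:t} ∣ X_{1:m})`. -/
noncomputable def cappedMass (p q : Model V) (xs : List V) : ℝ :=
  jointProb q (xs.take (maxIndex p q xs)) *
    condProb p (xs.take (maxIndex p q xs)) (xs.drop (maxIndex p q xs))

theorem cappedMass_nonneg (p q : Model V) (xs : List V) : 0 ≤ cappedMass p q xs :=
  mul_nonneg (jointProb_nonneg _ _) (condProb_nonneg _ _ _)

theorem cappedMass_eq_div (p q : Model V) (xs : List V) :
    cappedMass p q xs = jointProb p xs / maxRatio p q xs := by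
  have h1 := one_le_maxRatio p q xs
  rw [eq_div_iff (by linarith)]
  conv_rhs => rw [← List.take_append_drop (maxIndex p q xs) xs, jointProb_append]
  -- A zero denominator would make the ratio 0 by convention, contradicting that it is at least 1.
  have hq : jointProb q (xs.take (maxIndex p q xs)) ≠ 0 := fun h => by
    rw [maxRatio, ratio, h, div_zero] at h1
    linarith
  rw [cappedMass, maxRatio, ratio]
  field_simp

theorem cappedRatio_mul (p q : Model V) (xs : List V) (h : jointProb q xs ≠ 0) :
    cappedRatio p q xs * jointProb q xs = cappedMass p q xs := by
  rw [cappedRatio, ← maxRatio, min_eq_right (one_le_maxRatio p q xs), one_mul, condRatio,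
    cappedMass]
  have hx : jointProb q xs = jointProb q (xs.take (maxIndex p q xs)) *
      condProb q (xs.take (maxIndex p q xs)) (xs.drop (maxIndex p q xs)) := by
    rw [← jointProb_append, List.take_append_drop]
  rw [hx] at h ⊢
  have := left_ne_zero_of_mul h
  have := right_ne_zero_of_mul h
  field_simp

theorem cappedRatio_nonneg (p q : Model V) (xs : List V) : 0 ≤ cappedRatio p q xs := by
  rw [cappedRatio, ← maxRatio, min_eq_right (one_le_maxRatio p q xs), one_mul]
  exact div_nonneg (condProb_nonneg _ _ _) (condProb_nonneg _ _ _)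

theorem cappedExcess_eq (p q : Model V) (xs : List V) :
    cappedExcess p q xs = cappedMass p q xs - jointProb q xs := by
  rw [cappedExcess]
  split_ifs with h
  · rw [h, sub_zero, cappedMass]
  · rw [sub_mul, cappedRatio_mul p q xs h, one_mul]

/-- The part of the capped mass covered by the draft. -/
noncomputable def coveredMass (p q : Model V) (xs : List V) : ℝ :=
  min (cappedMass p q xs) (jointProb q xs)

theorem coveredMass_eq_zero (p q : Model V) {xs : List V} (h : jointProb q xs = 0) :
    coveredMass p q xs = 0 := by
  rw [coveredMass, h, min_eq_right (cappedMass_nonneg p q xs)]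

theorem coveredMass_nil (p q : Model V) : coveredMass p q [] = 1 := by
  simp [coveredMass, cappedMass_eq_div, maxRatio_nil]

/-- The identity behind it is p / max(M, p/q) = min(p/M, q), with M the running maximum at `pre`. -/
theorem cappedMass_append_singleton (p q : Model V) {pre : List V} (x : V)
    (h : jointProb q pre ≠ 0) :
    cappedMass p q (pre ++ [x]) = coveredMass p q pre * (p pre x).toReal := by
  have hq : 0 < jointProb q pre := (jointProb_nonneg q pre).lt_of_ne' h
  have hm : 0 < maxRatio p q pre := zero_lt_one.trans_le (one_le_maxRatio p q pre)
  rw [cappedMass_eq_div, maxRatio_append_singleton, jointProb_append_singleton, coveredMass,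
    cappedMass_eq_div, mul_div_right_comm, ratio]
  congr 1
  rcases (jointProb_nonneg p pre).eq_or_lt with hp | hp
  -- Cancelling p is impossible when p(pre) = 0, but then both sides vanish.
  · simp [← hp, hq.le]
  · rcases le_total (maxRatio p q pre) (jointProb p pre / jointProb q pre) with h1 | h1
    · rw [max_eq_right h1, div_div_cancel₀ hp.ne', min_eq_right]
      rwa [le_div_iff₀ hm, mul_comm, ← le_div_iff₀ hq]
    · rw [max_eq_left h1, min_eq_left]
      rwa [div_le_iff₀ hm, mul_comm, ← div_le_iff₀ hq]

theorem max_cappedExcess (p q : Model V) (xs : List V) :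
    max (cappedExcess p q xs) 0 = cappedMass p q xs - coveredMass p q xs := by
  rw [cappedExcess_eq, coveredMass]
  rcases le_total (cappedMass p q xs) (jointProb q xs) with h | h
  · rw [max_eq_right (by linarith), min_eq_left h, sub_self]
  · rw [max_eq_left (by linarith), min_eq_right h]

theorem max_neg_cappedExcess (p q : Model V) (xs : List V) :
    max (-cappedExcess p q xs) 0 = jointProb q xs - coveredMass p q xs := by
  rw [cappedExcess_eq, coveredMass]
  rcases le_total (cappedMass p q xs) (jointProb q xs) with h | h
  · rw [max_eq_left (by linarith), min_eq_left h, neg_sub]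
  · rw [max_eq_right (by linarith), min_eq_right h, sub_self]

end Ratios

/-! ### Mass balance at a branching point. -/

section Branch

variable {V : Type*} [Fintype V]

theorem sum_toReal (μ : PMF V) : ∑ x, (μ x).toReal = 1 := by
  rw [← ENNReal.toReal_sum fun x _ => μ.apply_ne_top x, ← tsum_fintype (L := .unconditional V),
    μ.tsum_coe, ENNReal.toReal_one]

theorem cappedDivPQ_nonneg (p q : Model V) (pre : List V) : 0 ≤ cappedDivPQ p q pre :=
  Finset.sum_nonneg fun _ _ => le_max_right _ _

theorem cappedDivQP_nonneg (p q : Model V) (pre : List V) : 0 ≤ cappedDivQP p q pre :=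
  Finset.sum_nonneg fun _ _ => le_max_right _ _

theorem cappedDivQP_eq_zero (p q : Model V) {pre : List V} (h : jointProb q pre = 0) :
    cappedDivQP p q pre = 0 := by
  refine Finset.sum_eq_zero fun x _ => ?_
  have hx : jointProb q (pre ++ [x]) = 0 := by rw [jointProb_append_singleton, h, zero_mul]
  rw [max_neg_cappedExcess, hx, coveredMass_eq_zero p q hx, sub_zero]

/-- The covered masses of the children cancel in the difference; what remains sums by normalization
of p and q. -/
theorem cappedDivQP_sub_cappedDivPQ (p q : Model V) {pre : List V} (h : jointProb q pre ≠ 0) :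
    cappedDivQP p q pre - cappedDivPQ p q pre = jointProb q pre - coveredMass p q pre := by
  rw [cappedDivQP, cappedDivPQ, ← Finset.sum_sub_distrib]
  simp only [max_neg_cappedExcess, max_cappedExcess, sub_sub_sub_cancel_right,
    cappedMass_append_singleton p q _ h, jointProb_append_singleton]
  rw [Finset.sum_sub_distrib, ← Finset.mul_sum, ← Finset.mul_sum, sum_toReal, sum_toReal,
    mul_one, mul_one]

theorem cappedDivPQ_le_cappedDivQP (p q : Model V) {pre : List V} (h : jointProb q pre ≠ 0) :
    cappedDivPQ p q pre ≤ cappedDivQP p q pre := by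
  have := cappedDivQP_sub_cappedDivPQ p q h
  have : coveredMass p q pre ≤ jointProb q pre := min_le_right _ _
  linarith

/-- The acceptance probability of a proper prefix, capped at `1`. -/
noncomputable def branchAccept (p q : Model V) (pre : List V) : ℝ :=
  min (cappedDivPQ p q pre / cappedDivQP p q pre) 1

theorem cappedDivQP_mul_branchAccept (p q : Model V) {pre : List V} (h : jointProb q pre ≠ 0) :
    cappedDivQP p q pre * branchAccept p q pre = cappedDivPQ p q pre := by
  have hle := cappedDivPQ_le_cappedDivQP p q h
  have h0 := cappedDivPQ_nonneg p q pre
  rcases (cappedDivQP_nonneg p q pre).eq_or_lt with hz | hz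
  -- If D*(q,p) = 0, then D*(p,q) lies between 0 and 0, so the default quotient is harmless.
  · rw [← hz, zero_mul]
    linarith
  · rw [branchAccept, min_eq_left ((div_le_one hz).2 hle), mul_div_cancel₀ _ hz.ne']

/-- The right side is a summand of the parent's `cappedDivQP`, which is what closes the backward
induction. -/
theorem cappedDivQP_mul_one_sub_branchAccept (p q : Model V) (pre : List V) :
    cappedDivQP p q pre * (1 - branchAccept p q pre) = max (-cappedExcess p q pre) 0 := by
  rw [max_neg_cappedExcess]
  by_cases h : jointProb q pre = 0
  · rw [cappedDivQP_eq_zero p q h, h, coveredMass_eq_zero p q h, zero_mul, sub_zero]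
  · rw [mul_sub, mul_one, cappedDivQP_mul_branchAccept p q h, cappedDivQP_sub_cappedDivPQ p q h]

theorem cappedDivPQ_mul_resample (p q : Model V) (pre : List V) (x : V) :
    cappedDivPQ p q pre * (resample p q pre x).toReal =
      max (cappedExcess p q (pre ++ [x])) 0 := by
  rw [resample]
  split_ifs with h
  · rw [h, zero_mul]
    exact ((Finset.sum_eq_zero_iff_of_nonneg fun _ _ => le_max_right _ _).1 h x
      (Finset.mem_univ x)).symm
  · rw [PMF.ofFintype_apply, ENNReal.toReal_ofReal
      (div_nonneg (le_max_right _ _) (cappedDivPQ_nonneg p q pre)), mul_div_cancel₀ _ h]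

/-- This is one increment of the telescoping sum over τ. -/
theorem cappedDivQP_mul_branchAccept_mul_resample (p q : Model V) (pre : List V) (x : V) :
    cappedDivQP p q pre * (branchAccept p q pre * (resample p q pre x).toReal) =
      coveredMass p q pre * (p pre x).toReal - coveredMass p q (pre ++ [x]) := by
  by_cases h : jointProb q pre = 0
  · rw [cappedDivQP_eq_zero p q h, coveredMass_eq_zero p q h, coveredMass_eq_zero]
    · simp
    · rw [jointProb_append_singleton, h, zero_mul]
  · rw [← mul_assoc, cappedDivQP_mul_branchAccept p q h, cappedDivPQ_mul_resample,
      max_cappedExcess, cappedMass_append_singleton p q x h]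

/-- The root has no acceptance test: its draft mass is fully covered, so the two divergences
coincide there. -/
theorem cappedDivQP_nil_mul_resample (p q : Model V) (x : V) :
    cappedDivQP p q [] * (resample p q [] x).toReal =
      (p [] x).toReal - coveredMass p q [x] := by
  have h1 : jointProb q [] ≠ 0 := by simp
  have h := cappedDivQP_sub_cappedDivPQ p q h1
  rw [coveredMass_nil, jointProb_nil, sub_self, sub_eq_zero] at h
  have h2 := cappedMass_append_singleton p q x h1
  rw [coveredMass_nil, one_mul, List.nil_append] at h2
  rw [h, cappedDivPQ_mul_resample, List.nil_append, max_cappedExcess, h2]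

end Branch

/-! ### Real-valued expectations over drafts. -/

section Expectation

variable {V : Type*} [Fintype V]

/-- The expectation of `f` over the extensions of `pre` by `n` tokens sampled from `q`. -/
noncomputable def expect (q : Model V) : ℕ → List V → (List V → ℝ) → ℝ
  | 0, pre, f => f pre
  | n + 1, pre, f => ∑ x, (q pre x).toReal * expect q n (pre ++ [x]) f

theorem expect_congr (q : Model V) {n : ℕ} {pre : List V} {f g : List V → ℝ}
    (h : ∀ ys, pre <+: ys → ys.length = pre.length + n → f ys = g ys) :
    expect q n pre f = expect q n pre g := by
  induction n generalizing pre with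
  | zero => exact h pre List.prefix_rfl rfl
  | succ n ih =>
    refine Finset.sum_congr rfl fun x _ => ?_
    rw [ih fun ys h1 h2 => h ys ((List.prefix_append _ _).trans h1) ?_]
    rw [h2, List.length_append, List.length_singleton]
    omega

theorem expect_const_mul (q : Model V) (n : ℕ) (pre : List V) (c : ℝ) (f : List V → ℝ) :
    expect q n pre (fun ys => c * f ys) = c * expect q n pre f := by
  induction n generalizing pre with
  | zero => rfl
  | succ n ih =>
    simp only [expect, ih, Finset.mul_sum]
    exact Finset.sum_congr rfl fun x _ => by ring

theorem expect_add (q : Model V) (n : ℕ) (pre : List V) (f g : List V → ℝ) :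
    expect q n pre (fun ys => f ys + g ys) = expect q n pre f + expect q n pre g := by
  induction n generalizing pre with
  | zero => rfl
  | succ n ih => simp only [expect, ih, mul_add, Finset.sum_add_distrib]

theorem expect_eq_zero (q : Model V) {n : ℕ} {pre : List V} {f : List V → ℝ}
    (h : ∀ ys, pre <+: ys → ys.length = pre.length + n → f ys = 0) :
    expect q n pre f = 0 := by
  rw [expect_congr q (g := fun ys => 0 * f ys) fun ys h1 h2 => by rw [h ys h1 h2, zero_mul],
    expect_const_mul, zero_mul]

theorem expect_of_prefix (q : Model V) (n : ℕ) (pre v : List V) {f : List V → ℝ}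
    (h : ∀ ys, ys.length = pre.length + (v.length + n) → ¬ pre ++ v <+: ys → f ys = 0) :
    expect q (v.length + n) pre f = condProb q pre v * expect q n (pre ++ v) f := by
  induction v generalizing pre with
  | nil => simp [condProb]
  | cons x v ih =>
    have ih' := ih (pre ++ [x]) fun ys h1 h2 => h ys
      (by simp only [List.length_append, List.length_cons, List.length_nil] at h1 ⊢; omega)
      (by simpa using h2)
    rw [List.length_cons, Nat.add_right_comm, expect, Finset.sum_eq_single x]
    · rw [ih', condProb, mul_assoc, List.append_assoc, List.singleton_append]
    · intro y _ hy
      rw [expect_eq_zero, mul_zero]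
      intro ys h1 h2
      refine h ys ?_ fun h3 => hy ?_
      · simp only [List.length_append, List.length_cons, List.length_nil] at h2 ⊢
        omega
      · have h4 : pre ++ [x] <+: ys := List.IsPrefix.trans ⟨v, by simp⟩ h3
        have h5 := (List.prefix_of_prefix_length_le h1 h4 (by simp)).eq_of_length (by simp)
        simpa using h5
    · simp

theorem toReal_bind_apply {α : Type*} (μ : PMF V) (F : V → PMF α) (z : α) :
    (μ.bind F z).toReal = ∑ x, (μ x).toReal * (F x z).toReal := by
  rw [PMF.bind_apply, tsum_fintype, ENNReal.toReal_sum fun x _ =>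
    ENNReal.mul_ne_top (μ.apply_ne_top x) ((F x).apply_ne_top z)]
  simp only [ENNReal.toReal_mul]

theorem toReal_extend_bind_apply {α : Type*} (q : Model V) (n : ℕ) (pre : List V)
    (F : List V → PMF α) (z : α) :
    ((extend q n pre).bind F z).toReal = expect q n pre fun ys => (F ys z).toReal := by
  induction n generalizing pre with
  | zero => simp [extend, expect]
  | succ n ih => simp only [extend, PMF.bind_bind, toReal_bind_apply, ih, expect]

end Expectation

/-! ### Probabilities of acceptance, completion and generation. -/

section Algorithm

theorem toReal_acceptTest_true (h : ℝ) : (acceptTest h true).toReal = max (min h 1) 0 := by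
  have hs : (fun η : ℝ => decide (η ≤ h)) ⁻¹' {true} = Set.Iic h := by ext; simp
  -- The null endpoint 1 is added so that the intersection is a half-open interval for every real h.
  have hI : Set.Iic h ∩ Set.Ioc 0 1 = Set.Ioc 0 (min h 1) := by
    ext y
    simp only [Set.mem_inter_iff, Set.mem_Iic, Set.mem_Ioc, le_min_iff]
    tauto
  rw [acceptTest, Measure.toPMF_apply,
    Measure.map_apply (measurable_decide_le h) (measurableSet_singleton _), hs, uniform01,
    restrict_Ioo_eq_restrict_Ioc, Measure.restrict_apply measurableSet_Iic, hI, Real.volume_Ioc,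
    sub_zero, ENNReal.toReal_ofReal']

theorem toReal_acceptTest_false (h : ℝ) : (acceptTest h false).toReal = 1 - max (min h 1) 0 := by
  have := sum_toReal (acceptTest h)
  rw [Fintype.sum_bool, toReal_acceptTest_true] at this
  linarith

variable {V : Type*} [Fintype V]

theorem acceptProb_length (p q : Model V) (ys : List V) :
    acceptProb p q ys ys.length = min (cappedRatio p q ys) 1 := if_pos rfl

theorem acceptProb_of_prefix (p q : Model V) {u ys : List V} (h : u <+: ys)
    (hl : u.length < ys.length) :
    acceptProb p q ys u.length = cappedDivPQ p q u / cappedDivQP p q u := by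
  rw [acceptProb, if_neg hl.ne, ← List.prefix_iff_eq_take.1 h]

/-- The probability that the verifier accepts the position `t` of `ys` when it is reached. -/
noncomputable def acceptWeight (p q : Model V) (ys : List V) (t : ℕ) : ℝ :=
  max (min (acceptProb p q ys t) 1) 0

theorem acceptWeight_of_prefix (p q : Model V) {u ys : List V} (h : u <+: ys)
    (hl : u.length < ys.length) : acceptWeight p q ys u.length = branchAccept p q u := by
  rw [acceptWeight, acceptProb_of_prefix p q h hl, branchAccept, max_eq_left]
  exact le_min (div_nonneg (cappedDivPQ_nonneg p q u) (cappedDivQP_nonneg p q u)) zero_le_one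

theorem acceptWeight_length (p q : Model V) (ys : List V) :
    acceptWeight p q ys ys.length = min (cappedRatio p q ys) 1 := by
  rw [acceptWeight, acceptProb_length, min_assoc, min_self, max_eq_left]
  exact le_min (cappedRatio_nonneg p q ys) zero_le_one

theorem jointProb_mul_acceptWeight_length (p q : Model V) (ys : List V) :
    jointProb q ys * acceptWeight p q ys ys.length = coveredMass p q ys := by
  by_cases h : jointProb q ys = 0
  · rw [coveredMass_eq_zero p q h, h, zero_mul]
  · rw [acceptWeight_length, coveredMass, ← cappedRatio_mul p q ys h, mul_comm,
      min_mul_of_nonneg _ _ (jointProb_nonneg q ys), one_mul]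

/-- The expectation of `f τ` for the position `τ` returned by `scan p q ys t`. -/
noncomputable def scanExpect (p q : Model V) (ys : List V) (f : ℕ → ℝ) : ℕ → ℝ
  | 0 => f 0
  | t + 1 => acceptWeight p q ys (t + 1) * f (t + 1) +
      (1 - acceptWeight p q ys (t + 1)) * scanExpect p q ys f t

theorem toReal_scan_bind_apply {α : Type*} (p q : Model V) (ys : List V) (F : ℕ → PMF α) (t : ℕ)
    (z : α) :
    ((scan p q ys t).bind F z).toReal = scanExpect p q ys (fun τ => (F τ z).toReal) t := by
  induction t with
  | zero => simp [scan, scanExpect]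
  | succ t ih =>
    rw [scan, PMF.bind_bind, toReal_bind_apply, Fintype.sum_bool, toReal_acceptTest_true,
      toReal_acceptTest_false]
    simp only [if_true, Bool.false_eq_true, if_false, PMF.pure_bind, ih, scanExpect, acceptWeight]

/-- The probability that the verifier rejects all positions of `ys` after `t`. -/
noncomputable def rejectAfter (p q : Model V) (ys : List V) (t : ℕ) : ℝ :=
  ∏ s ∈ Finset.Ico (t + 1) (ys.length + 1), (1 - acceptWeight p q ys s)

theorem rejectAfter_length (p q : Model V) (ys : List V) :
    rejectAfter p q ys ys.length = 1 := by simp [rejectAfter]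

theorem rejectAfter_eq_mul (p q : Model V) {ys : List V} {t : ℕ} (h : t < ys.length) :
    rejectAfter p q ys t = (1 - acceptWeight p q ys (t + 1)) * rejectAfter p q ys (t + 1) :=
  Finset.prod_eq_prod_Ico_succ_bot (Nat.succ_lt_succ h) _

/-- `D*(q, p ∣ u)` is the probability that the draft starts with `u` and all positions after `u` are rejected. -/
theorem jointProb_mul_expect_rejectAfter (p q : Model V) (n : ℕ) (u : List V) :
    jointProb q u * expect q (n + 1) u (fun ys => rejectAfter p q ys u.length) =
      cappedDivQP p q u := by
  induction n generalizing u with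
  | zero =>
    simp only [expect, Finset.mul_sum, cappedDivQP]
    refine Finset.sum_congr rfl fun x _ => ?_
    have hl : (u ++ [x]).length = u.length + 1 := by simp
    rw [rejectAfter_eq_mul p q (by simp), ← hl, rejectAfter_length, mul_one, ← mul_assoc,
      ← jointProb_append_singleton, mul_sub, mul_one, jointProb_mul_acceptWeight_length,
      max_neg_cappedExcess]
  | succ n ih =>
    rw [expect, Finset.mul_sum, cappedDivQP]
    refine Finset.sum_congr rfl fun x _ => ?_
    have hl : (u ++ [x]).length = u.length + 1 := by simp
    rw [expect_congr q (g := fun ys => (1 - branchAccept p q (u ++ [x])) *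
        rejectAfter p q ys (u ++ [x]).length), expect_const_mul, ← mul_assoc,
      ← jointProb_append_singleton, mul_left_comm, ih, mul_comm,
      cappedDivQP_mul_one_sub_branchAccept]
    intro ys h1 h2
    rw [rejectAfter_eq_mul p q (by omega), ← hl, acceptWeight_of_prefix p q h1 (by omega)]

/-- The completion of `ys` to length `γ` by the target model, cut off after `γ` tokens. -/
noncomputable def complete (p : Model V) (γ : ℕ) (ys : List V) : PMF (List V) :=
  (extend p (γ - ys.length) ys).map fun zs => zs.take γ

theorem toReal_complete_apply (p : Model V) (γ : ℕ) (ys xs : List V) :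
    (complete p γ ys xs).toReal =
      expect p (γ - ys.length) ys fun zs => (PMF.pure (zs.take γ) xs).toReal := by
  rw [complete, PMF.map, toReal_extend_bind_apply]
  rfl

theorem toReal_complete_append (p : Model V) (u w : List V) :
    (complete p (u ++ w).length u (u ++ w)).toReal = condProb p u w := by
  have hn : (u ++ w).length - u.length = w.length + 0 := by simp
  rw [toReal_complete_apply, hn, expect_of_prefix]
  · simp [expect]
  · intro ys h1 h2
    rw [List.take_of_length_le (by simp [h1]), PMF.pure_apply, if_neg, ENNReal.toReal_zero]
    rintro rfl
    exact h2 List.prefix_rfl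

theorem toReal_complete_of_not_prefix (p : Model V) {u xs : List V} (hl : u.length ≤ xs.length)
    (h : ¬ u <+: xs) : (complete p xs.length u xs).toReal = 0 := by
  rw [toReal_complete_apply, expect_eq_zero]
  intro ys h1 h2
  rw [List.take_of_length_le (by omega), PMF.pure_apply, if_neg, ENNReal.toReal_zero]
  rintro rfl
  exact h h1

theorem toReal_complete_append_singleton (p : Model V) {xs ys : List V}
    (hl : ys.length = xs.length) (x : V) [Decidable (ys = xs)] :
    (complete p xs.length (ys ++ [x]) xs).toReal = if ys = xs then 1 else 0 := by
  -- Truncated subtraction: with the bonus token nothing is left to sample, and `take` then drops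
  -- that token.
  have hn : xs.length - (ys ++ [x]).length = 0 := by simp; omega
  rw [toReal_complete_apply, hn, expect, List.take_left' hl, PMF.pure_apply]
  by_cases h : ys = xs
  · simp [h]
  · simp [h, Ne.symm h]

/-- The output of the verifier on the draft `ys` if `τ` tokens are accepted. -/
noncomputable def outcome (p q : Model V) (ys : List V) (τ : ℕ) : PMF (List V) :=
  if τ = ys.length then (p ys).map fun x => ys ++ [x]
  else (resample p q (ys.take τ)).map fun x => ys.take τ ++ [x]

/-- The probability that `xs` is generated from the draft `ys` if `τ` tokens are accepted. -/
noncomputable def outcomeProb (p q : Model V) (xs ys : List V) (τ : ℕ) : ℝ :=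
  ((outcome p q ys τ).bind (complete p xs.length) xs).toReal

theorem toReal_map_bind_apply {α β : Type*} (μ : PMF V) (g : V → α) (F : α → PMF β) (z : β) :
    ((μ.map g).bind F z).toReal = ∑ x, (μ x).toReal * (F (g x) z).toReal := by
  rw [PMF.bind_map, toReal_bind_apply]
  rfl

theorem outcomeProb_length (p q : Model V) {xs ys : List V} (hl : ys.length = xs.length)
    [Decidable (ys = xs)] : outcomeProb p q xs ys ys.length = if ys = xs then 1 else 0 := by
  rw [outcomeProb, outcome, if_pos rfl, toReal_map_bind_apply]
  simp only [toReal_complete_append_singleton p hl]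
  rw [← Finset.sum_mul, sum_toReal, one_mul]

theorem outcomeProb_of_prefix (p q : Model V) {u w ys : List V} {x : V}
    (hl : ys.length = (u ++ x :: w).length) (h : u <+: ys) :
    outcomeProb p q (u ++ x :: w) ys u.length =
      (resample p q u x).toReal * condProb p (u ++ [x]) w := by
  have hlt : u.length ≠ ys.length := by simp [hl]
  rw [outcomeProb, outcome, if_neg hlt, ← List.prefix_iff_eq_take.1 h, toReal_map_bind_apply,
    Finset.sum_eq_single x]
  · have := toReal_complete_append p (u ++ [x]) w
    rw [List.append_assoc, List.singleton_append] at this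
    rw [this]
  · intro y _ hy
    rw [toReal_complete_of_not_prefix p (by simp), mul_zero]
    rw [List.prefix_append_right_inj]
    simpa using hy
  · simp

theorem outcomeProb_of_not_prefix (p q : Model V) {u w ys : List V} {x : V}
    (hl : ys.length = (u ++ x :: w).length) (h : ¬ u <+: ys) :
    outcomeProb p q (u ++ x :: w) ys u.length = 0 := by
  have hlt : u.length < ys.length := by simp [hl]
  rw [outcomeProb, outcome, if_neg hlt.ne, toReal_map_bind_apply]
  refine Finset.sum_eq_zero fun y _ => ?_
  rw [toReal_complete_of_not_prefix p (by simp [hl]), mul_zero]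
  intro h1
  -- The kept prefix of `ys` has the length of `u`; if both begin the same list, they agree.
  have h2 : ys.take u.length <+: u ++ x :: w := (List.prefix_append _ _).trans h1
  have h3 := (List.prefix_of_prefix_length_le h2 (List.prefix_append u (x :: w))
    (by simp)).eq_of_length (by simp [hlt.le])
  exact h (h3 ▸ List.take_prefix _ _)

theorem toReal_generate_apply (p q : Model V) (xs : List V) :
    (generate p q xs.length xs).toReal =
      expect q xs.length [] fun ys =>
        scanExpect p q ys (outcomeProb p q xs ys) ys.length := by
  change (((extend q xs.length []).bind (verify p q)).bind (complete p xs.length) xs).toReal = _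
  rw [PMF.bind_bind, toReal_extend_bind_apply]
  congr 1
  funext ys
  change (((scan p q ys ys.length).bind (outcome p q ys)).bind (complete p xs.length) xs).toReal = _
  rw [PMF.bind_bind, toReal_scan_bind_apply]
  rfl

/-- The weight `a` lets one lemma serve both τ = 0, with weight 1, and τ > 0, with the acceptance
probability at `u`. -/
theorem jointProb_mul_expect_outcomeProb (p q : Model V) (u w : List V) (x : V)
    (a : List V → ℝ) (c : ℝ)
    (ha : ∀ ys, u <+: ys → ys.length = (u ++ x :: w).length → a ys = c) :
    expect q (u ++ x :: w).length [] (fun ys => rejectAfter p q ys u.length *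
        (a ys * outcomeProb p q (u ++ x :: w) ys u.length)) =
      cappedDivQP p q u * (c * (resample p q u x).toReal) * condProb p (u ++ [x]) w := by
  have hn : (u ++ x :: w).length = u.length + (w.length + 1) := by simp
  rw [← jointProb_mul_expect_rejectAfter p q w.length u, jointProb]
  conv_lhs => rw [hn]
  rw [expect_of_prefix, List.nil_append, expect_congr q (g := fun ys =>
    (c * (resample p q u x).toReal * condProb p (u ++ [x]) w) * rejectAfter p q ys u.length),
    expect_const_mul]
  · ring
  · intro ys h1 h2
    rw [ha ys h1 (h2.trans hn.symm), outcomeProb_of_prefix p q (h2.trans hn.symm) h1]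
    ring
  · intro ys h1 h2
    rw [outcomeProb_of_not_prefix p q (by simpa [hn] using h1) (by simpa using h2)]
    simp

/-- The probability that `X_{1:γ}` is generated with `τ ≤ t`, for `t < γ`. -/
theorem expect_rejectAfter_mul_scanExpect (p q : Model V) (u w : List V) (x : V) :
    expect q (u ++ x :: w).length [] (fun ys => rejectAfter p q ys u.length *
        scanExpect p q ys (outcomeProb p q (u ++ x :: w) ys) u.length) =
      jointProb p (u ++ x :: w) - coveredMass p q (u ++ [x]) * condProb p (u ++ [x]) w := by
  induction u using List.reverseRecOn generalizing x w with
  | nil =>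
    have h := jointProb_mul_expect_outcomeProb p q [] w x (fun _ => 1) 1 fun _ _ _ => rfl
    simp only [one_mul] at h
    rw [cappedDivQP_nil_mul_resample] at h
    refine h.trans ?_
    simp only [List.nil_append, jointProb, condProb]
    ring
  | append_singleton u y ih =>
    have ih' := ih (x :: w) y
    have hxs : u ++ y :: x :: w = (u ++ [y]) ++ x :: w := by simp
    have hl : (u ++ [y]).length = u.length + 1 := by simp
    rw [hxs] at ih'
    -- Split according to whether τ equals the length of `u ++ [y]` or is smaller.
    rw [expect_congr q (g := fun ys =>
      rejectAfter p q ys (u ++ [y]).length * (acceptWeight p q ys (u ++ [y]).length *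
        outcomeProb p q ((u ++ [y]) ++ x :: w) ys (u ++ [y]).length) +
      rejectAfter p q ys u.length *
        scanExpect p q ys (outcomeProb p q ((u ++ [y]) ++ x :: w) ys) u.length), expect_add, ih',
      jointProb_mul_expect_outcomeProb p q (u ++ [y]) w x _ (branchAccept p q (u ++ [y])),
      cappedDivQP_mul_branchAccept_mul_resample, condProb]
    -- The terms with c(uy) p(x∣uy) cancel: this is the telescoping.
    · ring
    · intro ys h1 h2
      exact acceptWeight_of_prefix p q h1 (by simp [h2])
    · intro ys _ h2
      rw [rejectAfter_eq_mul p q (t := u.length) (by simp [h2]), hl, scanExpect]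
      ring

theorem toReal_generate (p q : Model V) (xs : List V) :
    (generate p q xs.length xs).toReal = jointProb p xs := by
  classical
  rw [toReal_generate_apply]
  rcases List.eq_nil_or_concat' xs with rfl | ⟨u, x, rfl⟩
  -- For γ = 0 the scan returns 0, which counts as full acceptance.
  · have h := outcomeProb_length p q (xs := []) (ys := []) rfl
    rw [if_pos rfl] at h
    exact h
  · have h := expect_rejectAfter_mul_scanExpect p q u [] x
    rw [condProb, mul_one] at h
    have hl : (u ++ [x]).length = u.length + 1 := by simp
    -- Separate τ = γ from τ < γ; in the first term only the draft equal to the target sequence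
    -- contributes.
    rw [expect_congr q (g := fun ys =>
      acceptWeight p q ys ys.length * (if ys = u ++ [x] then 1 else 0) +
      rejectAfter p q ys u.length *
        scanExpect p q ys (outcomeProb p q (u ++ [x]) ys) u.length), expect_add, h,
      ← Nat.add_zero (u ++ [x]).length, expect_of_prefix]
    · have := jointProb_mul_acceptWeight_length p q (u ++ [x])
      rw [jointProb] at this
      simp only [expect, List.nil_append, if_true, mul_one]
      rw [this]
      ring
    · intro ys h1 h2
      rw [if_neg, mul_zero]
      rintro rfl
      exact h2 List.prefix_rfl
    · intro ys _ h2
      have h3 : ys.length = (u ++ [x]).length := by simpa using h2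
      rw [← outcomeProb_length p q h3, rejectAfter_eq_mul p q (t := u.length) (by omega),
        ← hl, ← h3, rejectAfter_length, mul_one]
      conv_lhs => rw [h3, hl, scanExpect, ← hl, ← h3]

end Algorithm

end HSD

theorem mainTheorem1 {V : Type*} [Fintype V] (p q : HSD.Model V) (γ : ℕ)
    (xs : List V) (hxs : xs.length = γ) :
    (HSD.generate p q γ xs).toReal = HSD.jointProb p xs := by
  subst hxs
  exact HSD.toReal_generate p q xs
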